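/- Let $S$ be a scheme and let $\mathcal O$ be the structure sheaf $T\mapsto \Gamma(T,\mathcal O_T)$ on the big fppf site $\mathrm{Sch}_S$ of schemes over $S$. Let $\mathcal M$ be an $\mathcal O$-module on this site that is locally free of finite positive rank, and let $b\colon \mathcal M\times\mathcal M\to\mathcal O$ be a symmetric bilinear form that is regular, i.e. $m\mapsto b(m,-)$ is an isomorphism $\mathcal M\to\mathcal M^\vee$. Write $\eta_b$ for the adjoint anti-automorphism of $\mathcal End_{\mathcal O}(\mathcal M)$, characterized by $b(\eta_b(a)(m_1),m_2)=b(m_1,a(m_2))$, and $\varphi_b\colon \mathcal M\otimes_{\mathcal O}\mathcal M\to\mathcal End_{\mathcal O}(\mathcal M)$ for the morphism $m_1\otimes m_2\mapsto (m\mapsto m_1\,b(m_2,m))$. An involution of $\mathcal End_{\mathcal O}(\mathcal M)$ is called orthogonal if it is fppf-locally the adjoint involution of a regular symmetric bilinear form on $\mathcal M$. For an orthogonal involution $\sigma$ of the Azumaya algebra $\mathcal End_{\mathcal O}(\mathcal M)$, let $\mathcal Sym_\sigma=\mathrm{Ker}(\mathrm{Id}-\sigma)$; a quadratic pair $(\sigma,f)$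 consists of such a $\sigma$ and a linear form $f\colon\mathcal Sym_{\sigma}\to\mathcal O$ with $f(a+\sigma(a))=\mathrm{Trd}(a)$ for all sections $a$ of $\mathcal End_{\mathcal O}(\mathcal M)$ over all $T\in\mathrm{Sch}_S$, where $\mathrm{Trd}$ is the reduced trace (the usual trace of endomorphisms). A quadratic form $q\colon\mathcal M\to\mathcal O$ has the polar form $b_q(x,y)=q(x+y)-q(x)-q(y)$, and $q$ is called regular if $b_q$ is regular. Then $\mathcal End_{\mathcal O}(\mathcal M)$ is an Azumaya $\mathcal O$-algebra, $\eta_b$ is an orthogonal involution of it, $\varphi_b$ is an isomorphism of $\mathcal O$-modules, and the following hold. (i) If $b=b_q$ for a regular quadratic form $q$ on $\mathcal M$, then there is a unique linear form $f_q\colon \mathcal Sym_{\eta_b}\to\mathcal O$ such that $f_q(\varphi_b(m\otimes m))=q(m)$ for all $T\in\mathrm{Sch}_S$ and all $m\in\mathcal M(T)$. Moreover, $(\eta_b,f_q)$ is a quadratic pair. (ii) If $(\eta_b,f)$ is a quadratic pair, then there is a unique quadratic form $q_f\colon\mathcal M\to\mathcal O$ with $q_f(m)=f(\varphi_b(m\otimes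 m))$ for all $T\in\mathrm{Sch}_S$ and all $m\in\mathcal M(T)$, and its polar form is $b$. (iii) There is a linear form $f$ such that $(\eta_b,f)$ is a quadratic pair if and only if $b$ is the polar form of a regular quadratic form on $\mathcal M$. -/

import Mathlib

open CategoryTheory AlgebraicGeometry Opposite TensorProduct
universe u v u₁ v₁ w w₁ w₂ w₃
namespace QuadPair
noncomputable section
section RingedCategory
variable {C : Type u₁} [Category.{v₁} C]

/-- A presheaf of modules `T ↦ M(T) = M.sec T` over a presheaf of commutative rings `𝒪`, with its
restriction maps. The carrier universe is free, so that modules over the same `𝒪` living in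
different universes (such as `𝒪`, `M` and its internal Hom modules) can be used together. -/
structure OMod (𝒪 : Cᵒᵖ ⥤ CommRingCat.{u}) where
  sec : C → Type w
  [grp : ∀ T, AddCommGroup (sec T)]
  [mod : ∀ T, Module (𝒪.obj (op T)) (sec T)]
  res : ∀ {T V : C} (g : V ⟶ T), sec T →ₛₗ[(𝒪.map g.op).hom] sec V
  res_id : ∀ (T : C) (x : sec T), res (𝟙 T) x = x
  res_comp : ∀ {T V W : C} (g : V ⟶ T) (h : W ⟶ V) (x : sec T),
    res (h ≫ g) x = res h (res g x)

attribute [instance] OMod.grp OMod.mod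

variable {𝒪 : Cᵒᵖ ⥤ CommRingCat.{u}}

namespace OMod

variable (𝒪) in
/-- `𝒪` as a module over itself. -/
abbrev unit : OMod.{u, u₁, v₁, u} 𝒪 where
  sec T := 𝒪.obj (op T)
  res g :=
    { toFun x := (𝒪.map g.op).hom x
      map_add' x y := by simp
      map_smul' r x := by simp }
  res_id T x := by simp
  res_comp g h x := by simp

variable (𝒪) in
/-- The module `𝒪^ι`, for finite `ι` the free module on `ι`. -/
abbrev free (ι : Type w) : OMod.{u, u₁, v₁, max u w} 𝒪 where
  sec T := ι → 𝒪.obj (op T)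
  res g :=
    { toFun x i := (𝒪.map g.op).hom (x i)
      map_add' x y := by ext; simp
      map_smul' r x := by ext; simp }
  res_id T x := by ext; simp
  res_comp g h x := by ext; simp

/-- The presheaf tensor product `T ↦ M(T) ⊗ N(T)`. -/
abbrev tensor (M : OMod.{u, u₁, v₁, w₁} 𝒪) (N : OMod.{u, u₁, v₁, w₂} 𝒪) :
    OMod.{u, u₁, v₁, max w₁ w₂} 𝒪 where
  sec T := M.sec T ⊗[𝒪.obj (op T)] N.sec T
  res g := TensorProduct.map (M.res g) (N.res g)
  res_id T x := by
    induction x with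
    | zero => simp
    | tmul a b => rw [TensorProduct.map_tmul, res_id, res_id]
    | add a b ha hb => rw [map_add, ha, hb]
  res_comp g h x := by
    induction x with
    | zero => simp
    | tmul a b => simp only [TensorProduct.map_tmul, res_comp]
    | add a b ha hb => rw [map_add, map_add, map_add, ha, hb]

/-- Morphisms `M → N` of `𝒪`-modules. -/
@[ext]
structure Mor (M : OMod.{u, u₁, v₁, w₁} 𝒪) (N : OMod.{u, u₁, v₁, w₂} 𝒪) where
  app : ∀ T : C, M.sec T →ₗ[𝒪.obj (op T)] N.sec T
  naturality : ∀ {T V : C} (g : V ⟶ T) (x : M.sec T), N.res g (app T x) = app V (M.res g x)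

/-- Morphisms `M|_T → N|_T` of modules over the restriction of `𝒪` to the objects over `T`. -/
@[ext]
structure LocHom (M : OMod.{u, u₁, v₁, w₁} 𝒪) (N : OMod.{u, u₁, v₁, w₂} 𝒪) (T : C) where
  app : ∀ {V : C} (_ : V ⟶ T), M.sec V →ₗ[𝒪.obj (op V)] N.sec V
  naturality : ∀ {V W : C} (g : V ⟶ T) (h : W ⟶ V) (x : M.sec V),
    N.res h (app g x) = app (h ≫ g) (M.res h x)

/-- Isomorphisms of (pre)sheaves of modules are the morphisms that are bijective on sections. -/
def Mor.IsIso {M : OMod.{u, u₁, v₁, w₁} 𝒪} {N : OMod.{u, u₁, v₁, w₂} 𝒪} (φ : Mor M N) : Prop :=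
  ∀ T, Function.Bijective (φ.app T)

def Mor.restrict {M : OMod.{u, u₁, v₁, w₁} 𝒪} {N : OMod.{u, u₁, v₁, w₂} 𝒪} (φ : Mor M N) (T : C) :
    LocHom M N T where
  app {V} _ := φ.app V
  naturality _ h x := φ.naturality h x

namespace LocHom

variable {M : OMod.{u, u₁, v₁, w₁} 𝒪} {N : OMod.{u, u₁, v₁, w₂} 𝒪} {P : OMod.{u, u₁, v₁, w₃} 𝒪}
  {T : C}

instance : Zero (LocHom M N T) := ⟨{ app _ := 0, naturality g h x := by simp }⟩
instance : Add (LocHom M N T) :=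
  ⟨fun φ ψ =>
    { app g := φ.app g + ψ.app g, naturality g h x := by simp [φ.naturality, ψ.naturality] }⟩
instance : Neg (LocHom M N T) :=
  ⟨fun φ => { app g := -φ.app g, naturality g h x := by simp [φ.naturality] }⟩
instance : Sub (LocHom M N T) :=
  ⟨fun φ ψ =>
    { app g := φ.app g - ψ.app g, naturality g h x := by simp [φ.naturality, ψ.naturality] }⟩
instance : SMul ℕ (LocHom M N T) :=
  ⟨fun n φ => { app g := n • φ.app g, naturality g h x := by simp [φ.naturality] }⟩
instance : SMul ℤ (LocHom M N T) :=
  ⟨fun n φ => { app g := n • φ.app g, naturality g h x := by simp [φ.naturality] }⟩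

instance : AddCommGroup (LocHom M N T) :=
  Function.Injective.addCommGroup
    (fun (φ : LocHom M N T) (V : C) (g : V ⟶ T) => φ.app g)
    (fun _ _ h => LocHom.ext (funext fun V => funext fun g => congrFun (congrFun h V) g))
    rfl (fun _ _ => rfl) (fun _ => rfl) (fun _ _ => rfl) (fun _ _ => rfl) (fun _ _ => rfl)

instance : SMul (𝒪.obj (op T)) (LocHom M N T) :=
  ⟨fun r φ =>
    { app g := (𝒪.map g.op).hom r • φ.app g
      naturality g h x := by simp [φ.naturality] }⟩

@[simp]
theorem smul_app (r : 𝒪.obj (op T)) (φ : LocHom M N T) {V : C} (g : V ⟶ T) :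
    (r • φ).app g = (𝒪.map g.op).hom r • φ.app g := rfl

@[simp]
theorem add_app (φ ψ : LocHom M N T) {V : C} (g : V ⟶ T) :
    (φ + ψ).app g = φ.app g + ψ.app g := rfl

@[simp]
theorem zero_app {V : C} (g : V ⟶ T) : (0 : LocHom M N T).app g = 0 := rfl

@[ext]
theorem ext' {φ ψ : LocHom M N T} (h : ∀ (V : C) (g : V ⟶ T) (x : M.sec V), φ.app g x = ψ.app g x) :
    φ = ψ :=
  LocHom.ext (funext fun V => funext fun g => LinearMap.ext fun x => h V g x)

instance : Module (𝒪.obj (op T)) (LocHom M N T) where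
  one_smul φ := by ext; simp [smul_app]
  mul_smul r s φ := by ext; simp [smul_app, mul_smul]
  smul_zero r := by ext; simp [smul_app, zero_app]
  smul_add r φ ψ := by ext; simp [smul_app, add_app]
  add_smul r s φ := by ext; simp [smul_app, add_app, add_smul]
  zero_smul φ := by ext; simp [smul_app, zero_app]

def comp (ψ : LocHom N P T) (φ : LocHom M N T) : LocHom M P T where
  app g := ψ.app g ∘ₗ φ.app g
  naturality g h x := by simp [φ.naturality, ψ.naturality]

def id (M : OMod.{u, u₁, v₁, w₁} 𝒪) (T : C) : LocHom M M T where
  app _ := LinearMap.id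
  naturality _ _ _ := rfl

/-- Isomorphisms of (pre)sheaves of modules are the morphisms that are bijective on sections. -/
def IsIso (φ : LocHom M N T) : Prop := ∀ {V : C} (g : V ⟶ T), Function.Bijective (φ.app g)

def inv (φ : LocHom M N T) (hφ : φ.IsIso) : LocHom N M T where
  app g := (LinearEquiv.ofBijective (φ.app g) (hφ g)).symm
  naturality g h x := by
    obtain ⟨y, rfl⟩ := (LinearEquiv.ofBijective (φ.app g) (hφ g)).surjective x
    apply (LinearEquiv.ofBijective (φ.app (h ≫ g)) (hφ (h ≫ g))).injective
    simp [φ.naturality]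

/-- Restriction along `V ⟶ T`. -/
def res (φ : LocHom M N T) {V : C} (g : V ⟶ T) : LocHom M N V where
  app h := φ.app (h ≫ g)
  naturality h k x := by simp [φ.naturality]

@[simp]
theorem res_app (φ : LocHom M N T) {V W : C} (g : V ⟶ T) (h : W ⟶ V) :
    (φ.res g).app h = φ.app (h ≫ g) := rfl

end LocHom

/-- The internal Hom module `T ↦ Hom(M|_T, N|_T)`. -/
abbrev hom (M : OMod.{u, u₁, v₁, w₁} 𝒪) (N : OMod.{u, u₁, v₁, w₂} 𝒪) :
    OMod.{u, u₁, v₁, max u₁ v₁ w₁ w₂} 𝒪 where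
  sec T := LocHom M N T
  res g :=
    { toFun φ := φ.res g
      map_add' φ ψ := rfl
      map_smul' r φ := by ext; simp [LocHom.res, LocHom.smul_app] }
  res_id T φ := by ext; simp [LocHom.res]
  res_comp g h φ := by ext; simp [LocHom.res]

/-- The dual module `M^∨ = Hom(M, 𝒪)`. -/
abbrev dual (M : OMod.{u, u₁, v₁, w₁} 𝒪) : OMod.{u, u₁, v₁, max u u₁ v₁ w₁} 𝒪 := hom M (unit 𝒪)

/-- The endomorphism module `End(M) = Hom(M, M)`; its algebra structure is composition. -/
abbrev endo (M : OMod.{u, u₁, v₁, w₁} 𝒪) : OMod.{u, u₁, v₁, max u₁ v₁ w₁} 𝒪 := hom M M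

variable {M : OMod.{u, u₁, v₁, w₁} 𝒪} {N : OMod.{u, u₁, v₁, w₂} 𝒪}

@[ext]
theorem hom_ext {T : C} {φ ψ : (hom M N).sec T}
    (h : ∀ (V : C) (g : V ⟶ T) (x : M.sec V), LocHom.app φ g x = LocHom.app ψ g x) : φ = ψ :=
  LocHom.ext' h

/-- The transpose `a^∨ : N^∨|_T → M^∨|_T` of `a : M|_T → N|_T`, that is `l ↦ l ∘ a`. -/
def LocHom.transpose {T : C} (a : LocHom M N T) : LocHom (dual N) (dual M) T where
  app g :=
    { toFun l := LocHom.comp l (a.res g)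
      map_add' l l' := rfl
      map_smul' r l := rfl }
  naturality g h l := by
    ext V k x
    exact congrArg (LocHom.app l (k ≫ h)) (by simp [LocHom.res])

/-- The submodule `Sym(M, σ) = Ker(Id - σ)` of symmetric elements. -/
abbrev sym (σ : Mor M M) : OMod.{u, u₁, v₁, w₁} 𝒪 where
  sec T := LinearMap.eqLocus (σ.app T) LinearMap.id
  res g :=
    { toFun x := ⟨M.res g x.1, by
        have := x.2
        simp only [LinearMap.mem_eqLocus, LinearMap.id_apply] at this ⊢
        rw [← σ.naturality, this]⟩
      map_add' x y := by ext; simp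
      map_smul' r x := by ext; simp }
  res_id T x := by ext; simp [M.res_id]
  res_comp g h x := by ext; simp [M.res_comp]

variable (J : GrothendieckTopology C)

/-- `φ` is locally injective and locally surjective, that is, it becomes an isomorphism after
sheafification for `J`. -/
def Mor.IsLocallyBijective (φ : Mor M N) : Prop :=
  (∀ (T : C) (x y : M.sec T), φ.app T x = φ.app T y →
    ∃ R ∈ J T, ∀ ⦃V : C⦄ (g : V ⟶ T), R g → M.res g x = M.res g y) ∧
  (∀ (T : C) (z : N.sec T),
    ∃ R ∈ J T, ∀ ⦃V : C⦄ (g : V ⟶ T), R g → ∃ x : M.sec V, φ.app V x = N.res g z)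

variable (M) in
/-- `M|_T` is free of rank `n`. -/
def IsFreeOver (n : ℕ) (T : C) : Prop :=
  ∃ e : LocHom (free 𝒪 (Fin n)) M T, e.IsIso

variable (M) in
def IsFiniteLocallyFree : Prop :=
  ∀ T : C, ∃ R ∈ J T, ∀ ⦃V : C⦄ (g : V ⟶ T), R g → ∃ n : ℕ, M.IsFreeOver n V

variable (M) in
def IsLocallyFreeOfFinitePositiveRank : Prop :=
  ∀ T : C, ∃ R ∈ J T, ∀ ⦃V : C⦄ (g : V ⟶ T), R g → ∃ n : ℕ, 0 < n ∧ M.IsFreeOver n V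

/-- The action of a section `a` of `End(M)` over `T` on `M(T)`. -/
def act {T : C} (a : (endo M).sec T) : M.sec T →ₗ[𝒪.obj (op T)] M.sec T := LocHom.app a (𝟙 T)

/-- `t` is the reduced trace of the section `a` of `End(M)` over `T`: on each `V` over `T` on which
`M` becomes free of finite rank, `t` restricts to the trace of `a` in a basis of `M`. If `M` is
finite locally free and `𝒪` is a sheaf, this determines `t`. -/
def IsReducedTrace {T : C} (a : (endo M).sec T) (t : 𝒪.obj (op T)) : Prop :=
  ∀ ⦃V : C⦄ (g : V ⟶ T), (∃ n : ℕ, M.IsFreeOver n V) →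
    (𝒪.map g.op).hom t = LinearMap.trace (𝒪.obj (op V)) (M.sec V) (LocHom.app a g)

/-- The map `x ↦ a ∘ x ∘ b` on `End(M)|_T`. -/
def sandwichHom {T : C} (a b : (endo M).sec T) : (hom (endo M) (endo M)).sec T where
  app g :=
    { toFun x := LocHom.comp (LocHom.comp (LocHom.res a g) x) (LocHom.res b g)
      map_add' x y := by
        ext W k m
        exact map_add (LocHom.app a (k ≫ g)) _ _
      map_smul' r x := by
        ext W k m
        exact map_smul (LocHom.app a (k ≫ g)) _ _ }
  naturality g h x := by
    ext W k m
    change LocHom.app a ((k ≫ h) ≫ g) (LocHom.app x (k ≫ h) (LocHom.app b ((k ≫ h) ≫ g) m)) =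
      LocHom.app a (k ≫ h ≫ g) (LocHom.app x (k ≫ h) (LocHom.app b (k ≫ h ≫ g) m))
    rw [Category.assoc]

theorem sandwichHom_app_app {T V W : C} (a b : (endo M).sec T) (g : V ⟶ T) (x : (endo M).sec V)
    (h : W ⟶ V) (m : M.sec W) :
    LocHom.app (LocHom.app (sandwichHom a b) g x) h m =
      LocHom.app a (h ≫ g) (LocHom.app x h (LocHom.app b (h ≫ g) m)) := rfl

variable (M) in
/-- The sandwich morphism `End(M) ⊗ End(M)^op → Hom(End(M), End(M))`, `a ⊗ b ↦ (x ↦ a x b)`. -/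
def sandwich : Mor (tensor (endo M) (endo M)) (hom (endo M) (endo M)) where
  app T := TensorProduct.lift (LinearMap.mk₂ (𝒪.obj (op T)) (fun a b => sandwichHom a b)
    (by intro a a' b; ext; rfl)
    (by
      intro r a b
      ext V g x W h m
      change (𝒪.map (h ≫ g).op).hom r • a.app (h ≫ g) (x.app h (b.app (h ≫ g) m)) =
        (𝒪.map h.op).hom ((𝒪.map g.op).hom r) • a.app (h ≫ g) (x.app h (b.app (h ≫ g) m))
      simp)
    (by
      intro a b b'
      ext V g x W h m
      change a.app (h ≫ g) (x.app h (b.app (h ≫ g) m + b'.app (h ≫ g) m)) =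
        a.app (h ≫ g) (x.app h (b.app (h ≫ g) m)) + a.app (h ≫ g) (x.app h (b'.app (h ≫ g) m))
      simp)
    (by
      intro r a b
      ext V g x W h m
      change a.app (h ≫ g) (x.app h ((𝒪.map (h ≫ g).op).hom r • b.app (h ≫ g) m)) =
        (𝒪.map h.op).hom ((𝒪.map g.op).hom r) • a.app (h ≫ g) (x.app h (b.app (h ≫ g) m))
      simp))
  naturality g t := by
    induction t using TensorProduct.induction_on with
    | zero => exact (map_zero _).trans (map_zero _).symm
    | tmul a b =>
      ext V' g' x W k m
      change LocHom.app a (k ≫ g' ≫ g) (LocHom.app x k (LocHom.app b (k ≫ g' ≫ g) m)) =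
        LocHom.app a ((k ≫ g') ≫ g) (LocHom.app x k (LocHom.app b ((k ≫ g') ≫ g) m))
      rw [Category.assoc]
    | add x y hx hy =>
      rw [map_add, map_add, hx, hy]
      exact ((congrArg _ (map_add (TensorProduct.map _ _) x y)).trans (map_add _ _ _)).symm

variable (M) in
/-- `End(M)` is an Azumaya algebra: it is finite locally free, and the sandwich morphism from the
sheaf tensor product is an isomorphism. -/
def IsAzumayaEnd : Prop :=
  (endo M).IsFiniteLocallyFree J ∧ (sandwich M).IsLocallyBijective J

variable (M) in
/-- Bilinear forms `M × M → 𝒪`. -/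
@[ext]
structure BilForm where
  app : ∀ T : C, M.sec T →ₗ[𝒪.obj (op T)] M.sec T →ₗ[𝒪.obj (op T)] 𝒪.obj (op T)
  naturality : ∀ {T V : C} (g : V ⟶ T) (x y : M.sec T),
    (𝒪.map g.op).hom (app T x y) = app V (M.res g x) (M.res g y)

variable (M) in
/-- Quadratic forms `M → 𝒪`. -/
@[ext]
structure QuadForm where
  app : ∀ T : C, QuadraticForm (𝒪.obj (op T)) (M.sec T)
  naturality : ∀ {T V : C} (g : V ⟶ T) (x : M.sec T),
    (𝒪.map g.op).hom (app T x) = app V (M.res g x)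

namespace BilForm

variable (b : BilForm M)

/-- The form `b(x, _)` on `M|_T`. -/
def leftForm {T : C} (x : M.sec T) : (dual M).sec T where
  app g := b.app _ (M.res g x)
  naturality g h y := by
    simp only [res_comp]
    exact b.naturality h _ y

@[simp]
theorem leftForm_app {T V : C} (x : M.sec T) (g : V ⟶ T) :
    LocHom.app (b.leftForm x) g = b.app V (M.res g x) := rfl

/-- The morphism `d_b : M → M^∨`, `x ↦ b(x, _)`. -/
def toDual : Mor M (dual M) where
  app T :=
    { toFun x := b.leftForm x
      map_add' x y := by ext; simp
      map_smul' r x := by ext; simp }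
  naturality g x := by
    ext V k y
    exact congrArg (fun z => b.app V z y) (M.res_comp g k x)

def IsRegular : Prop := b.toDual.IsIso

def IsSymm : Prop := ∀ (T : C) (x y : M.sec T), b.app T x y = b.app T y x

/-- The endomorphism `d_b⁻¹ ∘ a^∨ ∘ d_b` of `M|_T`, where `d_b : M → M^∨` is `b.toDual`. -/
def adjointHom (hb : b.IsRegular) {T : C} (a : (endo M).sec T) : (endo M).sec T :=
  ((b.toDual.restrict T).inv (fun {V} _ => hb V)).comp
    ((LocHom.transpose a).comp (b.toDual.restrict T))

variable {b} in
theorem IsRegular.ext (hb : b.IsRegular) {T : C} {x y : M.sec T}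
    (h : ∀ (V : C) (g : V ⟶ T) (z : M.sec V), b.app V (M.res g x) z = b.app V (M.res g y) z) :
    x = y :=
  (hb T).injective (hom_ext h)

theorem app_adjointHom (hb : b.IsRegular) {T V W : C} (a : (endo M).sec T) (g : V ⟶ T)
    (h : W ⟶ V) (x : M.sec V) (y : M.sec W) :
    b.app W (M.res h (LocHom.app (b.adjointHom hb a) g x)) y =
      b.app W (M.res h x) (LocHom.app a (h ≫ g) y) := by
  have key : b.toDual.app V (LocHom.app (b.adjointHom hb a) g x) =
      LocHom.comp (b.toDual.app V x) (LocHom.res a g) :=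
    (LinearEquiv.ofBijective (b.toDual.app V) (hb V)).apply_symm_apply _
  exact congrArg (fun l : (dual M).sec V => LocHom.app l h y) key

/-- The adjoint anti-automorphism `η_b` of `End(M)`. -/
def adjoint (hb : b.IsRegular) : Mor (endo M) (endo M) where
  app T :=
    { toFun a := b.adjointHom hb a
      map_add' a a' := by
        ext V g x
        refine hb.ext fun W h y => ?_
        simp [app_adjointHom]
      map_smul' r a := by
        ext V g x
        refine hb.ext fun W h y => ?_
        simp [app_adjointHom] }
  naturality g a := by
    ext V h x
    refine hb.ext fun W k y => ?_
    refine (app_adjointHom b hb a (h ≫ g) k x y).trans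
      (Eq.trans ?_ (app_adjointHom b hb ((endo M).res g a) h k x y).symm)
    change b.app W (M.res k x) (a.app (k ≫ h ≫ g) y) = b.app W (M.res k x) (a.app ((k ≫ h) ≫ g) y)
    rw [Category.assoc]

/-- The endomorphism `m ↦ x b(y, m)` of `M|_T`. -/
def rankOne {T : C} (x y : M.sec T) : (endo M).sec T where
  app g := (b.app _ (M.res g y)).smulRight (M.res g x)
  naturality g h z := by simp [M.res_comp, b.naturality]

@[simp]
theorem rankOne_app {T V : C} (x y : M.sec T) (g : V ⟶ T) (z : M.sec V) :
    LocHom.app (b.rankOne x y) g z = b.app V (M.res g y) z • M.res g x := rfl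

/-- The morphism `φ_b : M ⊗ M → End(M)`, `x ⊗ y ↦ (m ↦ x b(y, m))`. -/
def phi : Mor (tensor M M) (endo M) where
  app T := TensorProduct.lift (LinearMap.mk₂ (𝒪.obj (op T)) (fun x y => b.rankOne x y)
    (by intro a a' b; ext; simp)
    (by intro r a b; ext; simp [smul_smul, mul_comm])
    (by intro a b b'; ext; simp [add_smul])
    (by intro r a b; ext; simp [smul_smul]))
  naturality g t := by
    induction t using TensorProduct.induction_on with
    | zero => exact (map_zero _).trans (map_zero _).symm
    | tmul x y =>
      ext V' h z
      change b.app V' (M.res (h ≫ g) y) z • M.res (h ≫ g) x =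
        b.app V' (M.res h (M.res g y)) z • M.res h (M.res g x)
      rw [M.res_comp, M.res_comp]
    | add s t hs ht =>
      rw [map_add, map_add, hs, ht]
      exact ((congrArg _ (map_add (TensorProduct.map _ _) s t)).trans (map_add _ _ _)).symm

theorem adjointHom_rankOne (hb : b.IsRegular) (hs : b.IsSymm) {T : C} (x y : M.sec T) :
    b.adjointHom hb (b.rankOne x y) = b.rankOne y x := by
  ext V g z
  refine hb.ext fun W h t => ?_
  rw [app_adjointHom]
  simp only [rankOne_app, map_smul, map_smulₛₗ, LinearMap.smul_apply, smul_eq_mul, b.naturality,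
    ← M.res_comp]
  rw [hs W (M.res h z)]
  exact mul_comm _ _

/-- The section `φ_b(m ⊗ m)` of `Sym(End(M), η_b)`. -/
def symSquare (hb : b.IsRegular) (hs : b.IsSymm) {T : C} (m : M.sec T) :
    (sym (b.adjoint hb)).sec T :=
  ⟨b.phi.app T (m ⊗ₜ m), b.adjointHom_rankOne hb hs m m⟩

end BilForm

/-- `σ` is an involution of the first kind of the `𝒪`-algebra `End(M)`: an `𝒪`-linear
anti-automorphism of order dividing two. -/
structure IsInvolution (σ : Mor (endo M) (endo M)) : Prop where
  map_id : ∀ T : C, σ.app T (LocHom.id M T) = LocHom.id M T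
  map_comp : ∀ (T : C) (a a' : (endo M).sec T),
    σ.app T (LocHom.comp a a') = LocHom.comp (σ.app T a') (σ.app T a)
  involutive : ∀ (T : C) (a : (endo M).sec T), σ.app T (σ.app T a) = a

/-- `σ` is orthogonal: locally for the topology `J`, it is the adjoint involution of a regular
symmetric bilinear form on `M|_V`; the form is given as an isomorphism `c : M|_V → M^∨|_V`. -/
def IsOrthogonal (σ : Mor (endo M) (endo M)) : Prop :=
  ∀ T : C, ∃ R ∈ J T, ∀ ⦃V : C⦄ (g : V ⟶ T), R g → ∃ c : LocHom M (dual M) V, c.IsIso ∧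
    (∀ ⦃W : C⦄ (h : W ⟶ V) (x y : M.sec W),
      (c.app h x).app (𝟙 W) y = (c.app h y).app (𝟙 W) x) ∧
    (∀ ⦃W : C⦄ (h : W ⟶ V) (a : (endo M).sec W) (x y : M.sec W),
      (c.app h (act (σ.app W a) x)).app (𝟙 W) y = (c.app h x).app (𝟙 W) (act a y))

/-- `(σ, f)` is a quadratic pair on `End(M)`: `End(M)` is an Azumaya algebra, `σ` is an orthogonal
involution on it, and `f : Sym(End(M), σ) → 𝒪` is a linear form with `f(a + σ(a)) = Trd(a)`
for all sections `a` of `End(M)`. -/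
structure IsQuadraticPair (σ : Mor (endo M) (endo M)) (f : Mor (sym σ) (unit 𝒪)) : Prop where
  azumaya : IsAzumayaEnd M J
  involution : IsInvolution σ
  orthogonal : IsOrthogonal J σ
  trace : ∀ (T : C) (a : (endo M).sec T) (s : (sym σ).sec T), s.1 = a + σ.app T a →
    IsReducedTrace a (f.app T s)


/-- The polar form `b_q(x, y) = q(x + y) - q(x) - q(y)`. -/
def QuadForm.polar (q : QuadForm M) : BilForm M where
  app T := (q.app T).polarBilin
  naturality g x y := by simp [QuadraticMap.polar, q.naturality]

/-- A quadratic form is regular if its polar form is. -/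
def QuadForm.IsRegular (q : QuadForm M) : Prop := q.polar.IsRegular

end OMod
end RingedCategory

/-! ### The big fppf site of a scheme -/

section Site

theorem isSheaf_globalFunctions : Presheaf.IsSheaf Scheme.fppfTopology.{u} Scheme.Γ.{u} := by
  intro E
  refine Presieve.isSheaf_iso _ (NatIso.ofComponents (fun X => Equiv.toIso
    ((ΓSpec.adjunction.homEquiv X.unop (op E)).symm.trans (opEquiv _ _)) ) ?_)
    (GrothendieckTopology.Subcanonical.isSheaf_of_isRepresentable
      (J := Scheme.fppfTopology.{u}) (yoneda.obj (Spec E)))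
  intro X Y f
  ext g
  have := ΓSpec.adjunction.homEquiv_naturality_left_symm f.unop (g : X.unop ⟶ Spec E)
  exact congrArg Quiver.Hom.unop this

theorem isSheafFor_globalFunctions {X : Scheme.{u}} (R : Sieve X) (hR : R ∈ Scheme.fppfTopology X) :
    Presieve.IsSheafFor (Scheme.Γ.{u} ⋙ forget CommRingCat) R.arrows := by
  let E : CommRingCat.{u} := CommRingCat.of (MvPolynomial PUnit.{u+1} (ULift.{u} ℤ))
  let φ {A : CommRingCat.{u}} (a : A) : E ⟶ A :=
    CommRingCat.ofHom (MvPolynomial.eval₂Hom ((Int.castRingHom A).comp ULift.ringEquiv.toRingHom)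
      (fun _ => a))
  have hφ {A : CommRingCat.{u}} (f g : E ⟶ A) (h : f.hom (MvPolynomial.X PUnit.unit) = g.hom (MvPolynomial.X PUnit.unit)) : f = g := by
    ext1
    refine MvPolynomial.ringHom_ext (fun r => ?_) (fun i => h)
    have : f.hom.comp ((MvPolynomial.C).comp ULift.ringEquiv.symm.toRingHom) =
      g.hom.comp ((MvPolynomial.C).comp ULift.ringEquiv.symm.toRingHom) := RingHom.ext_int _ _
    exact congrArg (fun k => k r.down) this
  refine Presieve.isSheafFor_iso (P := Scheme.Γ.{u} ⋙ coyoneda.obj (op E)) (NatIso.ofComponents (fun X => Equiv.toIso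
      { toFun f := f.hom (MvPolynomial.X PUnit.unit)
        invFun a := φ a
        left_inv f := hφ _ _ (MvPolynomial.eval₂_X _ _ _)
        right_inv a := MvPolynomial.eval₂_X _ _ _ }) ?_) (isSheaf_globalFunctions E R hR)
  intro X Y f
  ext g
  rfl

theorem isSheaf_globalFunctionsRing :
    Presheaf.IsSheaf Scheme.fppfTopology.{u} (Scheme.Γ.{u} ⋙ forget₂ CommRingCat RingCat) := by
  intro E X R hR x hx
  have hs := isSheafFor_globalFunctions R hR
  have hc (e : E) : Presieve.FamilyOfElements.Compatible (P := Scheme.Γ.{u} ⋙ forget CommRingCat)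
      (R := R.arrows) (fun Y f hf => (x f hf).hom e) := by
    intro Y₁ Y₂ Z g₁ g₂ f₁ f₂ h₁ h₂ h
    exact congrArg (fun k => k.hom e) (hx g₁ g₂ h₁ h₂ h)
  have uniq (a b : Γ(X, ⊤)) (h : ∀ Y (f : Y ⟶ X), R f → Scheme.Γ.map f.op a = Scheme.Γ.map f.op b) :
      a = b := hs.isSeparatedFor.ext (fun Y f hf => h Y f hf)
  let t (e : E) : Γ(X, ⊤) := hs.amalgamate _ (hc e)
  have ht (e : E) (Y) (f : Y ⟶ X) (hf : R f) : (Scheme.Γ.map f.op).hom (t e) = (x f hf).hom e :=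
    hs.valid_glue (hc e) f hf
  let T : E ⟶ (Scheme.Γ.{u} ⋙ forget₂ CommRingCat RingCat).obj (op X) := RingCat.ofHom
    (S := Γ(X, ⊤))
    { toFun := t
      map_one' := uniq _ _ fun Y f hf => (ht _ Y f hf).trans (by rw [map_one]; exact (map_one _).symm)
      map_zero' := uniq _ _ fun Y f hf => (ht _ Y f hf).trans (by rw [map_zero]; exact (map_zero _).symm)
      map_mul' a b := uniq _ _ fun Y f hf => (ht _ Y f hf).trans (by
        rw [map_mul]; refine Eq.trans ?_ (map_mul (Scheme.Γ.map f.op).hom _ _).symm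
        rw [ht a Y f hf, ht b Y f hf])
      map_add' a b := uniq _ _ fun Y f hf => (ht _ Y f hf).trans (by
        rw [map_add]; refine Eq.trans ?_ (map_add (Scheme.Γ.map f.op).hom _ _).symm
        rw [ht a Y f hf, ht b Y f hf]) }
  refine ⟨T, fun Y f hf => ?_, fun T' hT' => ?_⟩
  · apply RingCat.hom_ext
    ext e
    exact ht e Y f hf
  · apply RingCat.hom_ext
    ext e
    refine uniq _ _ fun Y f hf => Eq.trans ?_ (ht e Y f hf).symm
    exact congrArg (fun k => k.hom e) (hT' f hf)


/-- The big fppf topology on schemes over `S`. -/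
abbrev fppf (S : Scheme.{u}) : GrothendieckTopology (Over S) := Scheme.fppfTopology.over S

/-- The structure presheaf `T ↦ Γ(T, 𝒪_T)` on schemes over `S`. -/
abbrev structurePresheaf (S : Scheme.{u}) : (Over S)ᵒᵖ ⥤ CommRingCat.{u} :=
  (Over.forget S).op ⋙ Scheme.Γ

/-- The structure sheaf of the big fppf site of `S`, as a sheaf of rings. -/
def structureSheaf (S : Scheme.{u}) : Sheaf (fppf S) RingCat.{u} :=
  (Scheme.fppfTopology.overPullback RingCat S).obj ⟨_, isSheaf_globalFunctionsRing⟩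

instance {S : Scheme.{u}} (M : SheafOfModules.{v} (structureSheaf S)) (T : Over S) :
    Module ((structurePresheaf S).obj (op T)) (M.val.obj (op T)) :=
  (M.val.obj (op T)).isModule

/-- The sections and restriction maps of an `𝒪`-module on the big fppf site of `S`. -/
def ofSheaf {S : Scheme.{u}} (M : SheafOfModules.{v} (structureSheaf S)) :
    OMod.{u, u + 1, u, v} (structurePresheaf S) where
  sec T := M.val.obj (op T)
  res g :=
    { toFun x := M.val.map g.op x
      map_add' x y := map_add (M.val.map g.op).hom x y
      map_smul' r x := M.val.map_smul g.op r x }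
  res_id T x := (M.val.congr_map_apply op_id x).trans (by rw [M.val.map_id]; rfl)
  res_comp g h x := (M.val.congr_map_apply op_comp x).trans (M.val.map_comp_apply g.op h.op x)

end Site

end

end QuadPair

/-!
The statement is local for the fppf topology, because all that is used of the site is that the
structure presheaf is a sheaf and that each object has a covering by objects over which `M` is free;
the argument therefore takes place over an arbitrary site with a sheaf of rings.

Over an object `T` over which `M` is free (`OMod.LocalBasis`), a morphism `M|_T → N|_T` is the same
as a linear map `M(T) → N(T)` (`OMod.LocalBasis.homEquiv`). So the sandwich morphism of `End(M)`
becomes that of a matrix algebra (`OMod.LocalBasis.sandwich_bijective`) and, `b` being regular,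
`φ_b` becomes the isomorphism of `M(T)^∨ ⊗ M(T)` with the endomorphisms of `M(T)`
(`OMod.LocalBasis.phi_bijective`).

Since `η_b(φ_b(x ⊗ y)) = φ_b(y ⊗ x)`, the symmetric elements over such a `T` correspond under `φ_b`
to the tensors fixed by the swap, and these are spanned by the squares `m ⊗ m`
(`OMod.BilForm.span_range_symSquare`). Hence a linear form on them is determined by its values on
the squares. A form with values `q(m)` there exists: take the form on `M(T) ⊗ M(T)` given by a
bilinear, usually not symmetric, `β` with `β(m, m) = q(m)`. By uniqueness the local forms are
compatible with restriction, and they glue because `𝒪` is a sheaf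
(`OMod.BilForm.exists_linearForm`).

The link between the trace condition and the polar form is the identity
`φ_b((x + y) ⊗ (x + y)) = φ_b(x ⊗ x) + φ_b(y ⊗ y) + a + η_b(a)` with `a = φ_b(x ⊗ y)`, whose
endomorphism `a` has trace `b(y, x)`. Read in one direction it gives the trace condition for `f_q`
(`OMod.BilForm.apply_eq_trace`), in the other the polar form of `m ↦ f(φ_b(m ⊗ m))`
(`OMod.BilForm.apply_symSquare_add`).
-/

namespace QuadPair

namespace OMod

noncomputable section

variable {C : Type u₁} [Category.{v₁} C] {𝒪 : Cᵒᵖ ⥤ CommRingCat.{u}}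
  {M : OMod.{u, u₁, v₁, w₁} 𝒪} {N : OMod.{u, u₁, v₁, w₂} 𝒪} {T : C}
  {J : GrothendieckTopology C}

/-! ### Bases of a module over an object -/

variable (M T) in
/-- A basis of `M|_T` indexed by `ι`: sections of `M` over `T` whose restrictions along each
`g : V ⟶ T` form a basis of `M(V)`. The bases are part of the data; they are determined by `vec`. -/
structure LocalBasis (ι : Type w) where
  vec : ι → M.sec T
  basis : ∀ {V : C} (_ : V ⟶ T), Module.Basis ι (𝒪.obj (op V)) (M.sec V)
  basis_apply : ∀ {V : C} (g : V ⟶ T) (i : ι), basis g i = M.res g (vec i)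

namespace LocalBasis

variable {ι : Type w}

theorem basis_id (B : LocalBasis M T ι) (i : ι) : B.basis (𝟙 T) i = B.vec i := by
  rw [B.basis_apply, M.res_id]

/-- Restriction of a basis along `g : V ⟶ T`. -/
def restrict (B : LocalBasis M T ι) {V : C} (g : V ⟶ T) : LocalBasis M V ι where
  vec i := M.res g (B.vec i)
  basis h := B.basis (h ≫ g)
  basis_apply h i := by rw [B.basis_apply, M.res_comp]

/-- The image of the standard basis of `𝒪^n` under an isomorphism with `M|_T`. -/
def ofIso {n : ℕ} (e : LocHom (free 𝒪 (Fin n)) M T) (he : e.IsIso) : LocalBasis M T (Fin n) where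
  vec i := e.app (𝟙 T) (Pi.single i 1)
  basis g := .ofEquivFun (LinearEquiv.ofBijective (e.app g) (he g)).symm
  basis_apply g i := by
    rw [e.naturality, Category.comp_id]
    simp only [Module.Basis.coe_ofEquivFun, LinearEquiv.symm_symm, LinearEquiv.ofBijective_apply]
    congr 1
    ext j
    obtain rfl | h := eq_or_ne j i
    · simp
    · simp [h]

theorem isFreeOver [Finite ι] (B : LocalBasis M T ι) : M.IsFreeOver (Nat.card ι) T := by
  let b {V : C} (g : V ⟶ T) := (B.basis g).reindex (Finite.equivFin ι)
  refine ⟨{ app g := (b g).equivFun.symm.toLinearMap, naturality g h x := ?_ },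
    fun g => (b g).equivFun.symm.bijective⟩
  simp only [LinearEquiv.coe_coe, Module.Basis.equivFun_symm_apply, map_sum, map_smulₛₗ]
  refine Finset.sum_congr rfl fun i _ => ?_
  simp only [b, Module.Basis.reindex_apply, B.basis_apply, M.res_comp]
  rfl

variable (N) in
/-- Over an object over which `M` has a basis, a morphism out of `M` is the same as a linear map
on sections over that object. -/
def homEquiv (B : LocalBasis M T ι) :
    (hom M N).sec T ≃ₗ[𝒪.obj (op T)] (M.sec T →ₗ[𝒪.obj (op T)] N.sec T) where
  toFun φ := LocHom.app φ (𝟙 T)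
  map_add' _ _ := rfl
  map_smul' r φ := by
    rw [LocHom.smul_app, op_id, 𝒪.map_id]
    rfl
  invFun l :=
    { app g := (B.basis g).constr (𝒪.obj (op _)) fun i => N.res g (l (B.vec i))
      naturality {V W} g h := LinearMap.congr_fun <|
        show (N.res h).comp ((B.basis g).constr (𝒪.obj (op V)) fun i => N.res g (l (B.vec i))) =
          ((B.basis (h ≫ g)).constr (𝒪.obj (op W)) fun i => N.res (h ≫ g) (l (B.vec i))).comp
            (M.res h) from (B.basis g).ext fun i => by
          rw [LinearMap.comp_apply, LinearMap.comp_apply, B.basis_apply, ← M.res_comp,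
            ← B.basis_apply, ← B.basis_apply, Module.Basis.constr_basis,
            Module.Basis.constr_basis, N.res_comp] }
  left_inv φ := by
    refine LocHom.ext (funext fun V => funext fun g => (B.basis g).ext fun i => ?_)
    rw [Module.Basis.constr_basis, LocHom.naturality, Category.comp_id, B.basis_apply]
  right_inv l := by
    refine (B.basis (𝟙 T)).ext fun i => ?_
    rw [Module.Basis.constr_basis, N.res_id, B.basis_id]

theorem homEquiv_apply (B : LocalBasis M T ι) (φ : (hom M N).sec T) (x : M.sec T) :
    B.homEquiv N φ x = LocHom.app φ (𝟙 T) x := rfl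

/-- The matrix units attached to a basis of `M|_T` form a basis of `End(M)|_T`. -/
def endo [Fintype ι] [DecidableEq ι] (B : LocalBasis M T ι) : LocalBasis (endo M) T (ι × ι) where
  vec ij := (B.homEquiv M).symm ((B.basis (𝟙 T)).linearMap (B.basis (𝟙 T)) ij)
  basis {V} g := ((B.basis g).linearMap (B.basis g)).map ((B.restrict g).homEquiv M).symm
  basis_apply {V} g ij := by
    apply ((B.restrict g).homEquiv M).injective
    rw [Module.Basis.map_apply, LinearEquiv.apply_symm_apply]
    refine (B.basis g).ext fun k => ?_
    rw [Module.Basis.linearMap_apply_apply, homEquiv_apply]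
    have h := LocHom.naturality ((B.homEquiv M).symm
      ((B.basis (𝟙 T)).linearMap (B.basis (𝟙 T)) ij)) (𝟙 T) g (B.vec k)
    rw [← homEquiv_apply, LinearEquiv.apply_symm_apply, ← B.basis_id,
      Module.Basis.linearMap_apply_apply, B.basis_id, B.basis_id, ← B.basis_apply g k] at h
    rw [show g ≫ 𝟙 T = 𝟙 V ≫ g by simp] at h
    refine Eq.trans ?_ h
    split_ifs
    · exact B.basis_apply g _
    · exact (map_zero _).symm

end LocalBasis

theorem isFreeOver_iff_exists_localBasis {n : ℕ} :
    M.IsFreeOver n T ↔ Nonempty (LocalBasis M T (Fin n)) := by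
  refine ⟨fun ⟨e, he⟩ => ⟨.ofIso e he⟩, fun ⟨B⟩ => ?_⟩
  simpa using B.isFreeOver

/-! ### The sandwich morphism and `φ_b` over an object over which `M` is free -/

/-- For a matrix algebra, `a ⊗ b ↦ (x ↦ a x b)` is bijective; stated for a module `A` identified
with the matrix algebra and for a target `H` identified with the endomorphisms of `A`. -/
theorem bijective_of_apply_tmul_eq_mul_mul {R A H ι : Type*} [CommRing R] [AddCommGroup A]
    [Module R A] [AddCommGroup H] [Module R H] [Fintype ι] [DecidableEq ι]
    (E : A ≃ₗ[R] Matrix ι ι R) (K : H ≃ₗ[R] (A →ₗ[R] A)) (s : A ⊗[R] A →ₗ[R] H)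
    (h : ∀ a b x, E (K (s (a ⊗ₜ b)) x) = E a * E x * E b) : Function.Bijective s := by
  let m := (AlgHom.mulLeftRight R (Matrix ι ι R)).toLinearMap
  have hm : Function.Bijective m := Function.bijective_iff_has_inverse.mpr
    ⟨AlgHom.mulLeftRightMatrix_inv R ι,
      DFunLike.congr_fun (AlgHom.mulLeftRightMatrix.inv_comp R ι),
      DFunLike.congr_fun (AlgHom.mulLeftRightMatrix.comp_inv R ι)⟩
  have key : s = K.symm.toLinearMap ∘ₗ E.symm.conj.toLinearMap ∘ₗ m ∘ₗ
      (TensorProduct.congr E (E ≪≫ₗ MulOpposite.opLinearEquiv R)).toLinearMap := by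
    ext a b
    apply K.injective
    ext x
    apply E.injective
    simp [h, m, LinearEquiv.conj_apply]
  rw [key]
  exact K.symm.bijective.comp (E.symm.conj.bijective.comp
    (hm.comp (TensorProduct.congr E (E ≪≫ₗ MulOpposite.opLinearEquiv R)).bijective))

/-- Over an object over which `M` is free, the sandwich morphism is that of a matrix algebra. -/
theorem LocalBasis.sandwich_bijective {ι : Type w} [Fintype ι] [DecidableEq ι]
    (B : LocalBasis M T ι) : Function.Bijective ((sandwich M).app T) := by
  refine bijective_of_apply_tmul_eq_mul_mul
    (B.homEquiv M ≪≫ₗ LinearMap.toMatrix (B.basis (𝟙 T)) (B.basis (𝟙 T)))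
    (B.endo.homEquiv (OMod.endo M)) _ fun a b x => ?_
  simp only [LinearEquiv.trans_apply]
  rw [← LinearMap.toMatrix_comp, ← LinearMap.toMatrix_comp]
  congr 1
  ext y
  change LocHom.app a (𝟙 T ≫ 𝟙 T) (LocHom.app x (𝟙 T) (LocHom.app b (𝟙 T ≫ 𝟙 T) y)) = _
  rw [Category.comp_id]
  rfl

/-- Over an object over which `M` is free, `φ_b` is the canonical map from `M(T)^∨ ⊗ M(T)` to the
endomorphisms of `M(T)`, after `M(T)` is identified with its dual by `b`. -/
theorem LocalBasis.phi_bijective {ι : Type w} [Finite ι] (B : LocalBasis M T ι) {b : BilForm M}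
    (hb : b.IsRegular) : Function.Bijective (b.phi.app T) := by
  have := Module.Free.of_basis (B.basis (𝟙 T))
  have := Module.Finite.of_basis (B.basis (𝟙 T))
  let d : M.sec T ≃ₗ[𝒪.obj (op T)] Module.Dual (𝒪.obj (op T)) (M.sec T) :=
    LinearEquiv.ofBijective _ (hb T) ≪≫ₗ B.homEquiv (unit 𝒪)
  have key : (B.homEquiv M).toLinearMap ∘ₗ b.phi.app T =
      (dualTensorHom (𝒪.obj (op T)) (M.sec T) (M.sec T)) ∘ₗ
      (TensorProduct.comm (𝒪.obj (op T)) _ _ ≪≫ₗ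
        TensorProduct.congr d (LinearEquiv.refl _ _)).toLinearMap := by
    ext x y z
    change b.app T (M.res (𝟙 T) y) z • M.res (𝟙 T) x = b.app T (M.res (𝟙 T) y) z • x
    rw [M.res_id T x]
  refine ((B.homEquiv M).bijective.of_comp_iff' _).mp ?_
  refine (congrArg Function.Bijective (congrArg DFunLike.coe key)).mpr ?_
  exact (dualTensorHomEquiv (𝒪.obj (op T)) (M.sec T) (M.sec T)).bijective.comp
    (LinearEquiv.bijective _)

/-! ### Localization to objects over which `M` is free -/

theorem IsLocallyFreeOfFinitePositiveRank.isFiniteLocallyFree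
    (hM : M.IsLocallyFreeOfFinitePositiveRank J) : M.IsFiniteLocallyFree J := fun T => by
  obtain ⟨R, hR, h⟩ := hM T
  exact ⟨R, hR, fun V g hg => (h g hg).imp fun _ => And.right⟩

/-- A morphism that is bijective over each object over which `M` is free is locally bijective. -/
theorem IsFiniteLocallyFree.isLocallyBijective (hM : M.IsFiniteLocallyFree J)
    {P : OMod.{u, u₁, v₁, w₂} 𝒪} {Q : OMod.{u, u₁, v₁, w₃} 𝒪} (φ : Mor P Q)
    (hφ : ∀ (V : C) (n : ℕ), M.IsFreeOver n V → Function.Bijective (φ.app V)) :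
    φ.IsLocallyBijective J := by
  refine ⟨fun T x y hxy => ?_, fun T z => ?_⟩
  all_goals
    obtain ⟨R, hR, h⟩ := hM T
    refine ⟨R, hR, fun V g hg => ?_⟩
    obtain ⟨n, hn⟩ := h g hg
  · apply (hφ V n hn).injective
    rw [← φ.naturality, ← φ.naturality, hxy]
  · exact (hφ V n hn).surjective _

theorem IsFiniteLocallyFree.isAzumayaEnd (hM : M.IsFiniteLocallyFree J) : IsAzumayaEnd M J := by
  refine ⟨fun T => ?_, hM.isLocallyBijective _ fun V n hV => ?_⟩
  · obtain ⟨R, hR, h⟩ := hM T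
    refine ⟨R, hR, fun V g hg => ?_⟩
    obtain ⟨n, hn⟩ := h g hg
    obtain ⟨B⟩ := isFreeOver_iff_exists_localBasis.mp hn
    exact ⟨_, B.endo.isFreeOver⟩
  · obtain ⟨B⟩ := isFreeOver_iff_exists_localBasis.mp hV
    exact B.sandwich_bijective

theorem IsFiniteLocallyFree.phi_isLocallyBijective (hM : M.IsFiniteLocallyFree J) {b : BilForm M}
    (hb : b.IsRegular) : b.phi.IsLocallyBijective J :=
  hM.isLocallyBijective _ fun V n hV => by
    obtain ⟨B⟩ := isFreeOver_iff_exists_localBasis.mp hV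
    exact B.phi_bijective hb

/-! ### Linear forms defined locally -/

theorem eq_of_locally_eq (h𝒪 : Presieve.IsSheaf J (𝒪 ⋙ forget CommRingCat)) {R : Sieve T}
    (hR : R ∈ J T) {s t : 𝒪.obj (op T)}
    (h : ∀ ⦃V : C⦄ (g : V ⟶ T), R g → (𝒪.map g.op).hom s = (𝒪.map g.op).hom t) : s = t :=
  (h𝒪 R hR).isSeparatedFor.ext fun _ g hg => h g hg

/-- Linear forms on a module that agree over every object of a class `D` are equal, if each object
has a covering by objects of `D`. -/
theorem Mor.ext_of_locally_eq (h𝒪 : Presieve.IsSheaf J (𝒪 ⋙ forget CommRingCat)) {D : C → Prop}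
    (hD : ∀ T, ∃ R ∈ J T, ∀ ⦃V : C⦄ (g : V ⟶ T), R g → D V) {f f' : Mor N (unit 𝒪)}
    (h : ∀ V, D V → f.app V = f'.app V) : f = f' := by
  ext T x
  obtain ⟨R, hR, hRD⟩ := hD T
  refine eq_of_locally_eq h𝒪 hR fun V g hg => ?_
  exact (f.naturality g x).trans ((LinearMap.congr_fun (h V (hRD g hg)) _).trans
    (f'.naturality g x).symm)

/-- If each object has a covering by objects of a class `D`, then linear forms on the modules
`N(V)`, for `V` in `D`, that are compatible with restriction glue to a linear form on `N`. -/
theorem exists_mor_of_locally (h𝒪 : Presieve.IsSheaf J (𝒪 ⋙ forget CommRingCat)) {D : C → Prop}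
    (hD : ∀ T, ∃ R ∈ J T, ∀ ⦃V : C⦄ (g : V ⟶ T), R g → D V)
    (l : ∀ V, D V → N.sec V →ₗ[𝒪.obj (op V)] 𝒪.obj (op V))
    (hl : ∀ {V W : C} (g : W ⟶ V) (hV : D V) (hW : D W) (x : N.sec V),
      (𝒪.map g.op).hom (l V hV x) = l W hW (N.res g x)) :
    ∃ f : Mor N (unit 𝒪), ∀ V (hV : D V), f.app V = l V hV := by
  -- The value at `x` is glued from the values at its restrictions. It is characterized over all
  -- objects of `D` above `T`, not only those of the chosen covering, so that linearity and
  -- naturality follow from uniqueness.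
  have key (T : C) (x : N.sec T) : ∃ t : 𝒪.obj (op T), ∀ (V : C) (g : V ⟶ T) (hV : D V),
      (𝒪.map g.op).hom t = l V hV (N.res g x) := by
    obtain ⟨R, hR, hRD⟩ := hD T
    have hc : Presieve.FamilyOfElements.Compatible (P := 𝒪 ⋙ forget CommRingCat)
        (R := R.arrows) (fun V g hg => l V (hRD g hg) (N.res g x)) := by
      intro V₁ V₂ W g₁ g₂ f₁ f₂ h₁ h₂ h
      have hW : D W := hRD _ (R.downward_closed h₁ g₁)
      refine (hl g₁ (hRD _ h₁) hW _).trans (Eq.trans ?_ (hl g₂ (hRD _ h₂) hW _).symm)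
      rw [← N.res_comp, ← N.res_comp, h]
    obtain ⟨t, ht, -⟩ := h𝒪 R hR _ hc
    refine ⟨t, fun V g hV => eq_of_locally_eq h𝒪 (J.pullback_stable g hR) fun W h hh => ?_⟩
    have := ht (h ≫ g) hh
    rw [hl h hV (hRD _ hh), ← N.res_comp]
    refine Eq.trans ?_ this
    simp
  choose t ht using key
  have huniq (T : C) (x : N.sec T) (s : 𝒪.obj (op T)) (hs : ∀ (V : C) (g : V ⟶ T) (hV : D V),
      (𝒪.map g.op).hom s = l V hV (N.res g x)) : t T x = s := by
    obtain ⟨R, hR, hRD⟩ := hD T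
    exact eq_of_locally_eq h𝒪 hR fun V g hg => by rw [ht _ _ _ _ (hRD g hg), hs]
  refine ⟨{ app T := { toFun := t T, map_add' x y := ?_, map_smul' r x := ?_ },
            naturality {T V} g x := ?_ }, fun V hV => ?_⟩
  · exact huniq _ _ _ fun V g hV => by simp only [map_add, ht _ _ _ _ hV]
  · exact huniq _ _ _ fun V g hV => by
      simp only [smul_eq_mul, map_mul, map_smulₛₗ, ht _ _ _ _ hV, RingHom.id_apply]
  · refine (huniq _ _ _ fun W h hW => ?_).symm
    rw [← N.res_comp, ← ht _ _ _ _ hW]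
    simp
  · ext x
    refine huniq _ _ _ fun W g hW => hl g hV hW x

/-! ### The adjoint involution -/

namespace BilForm

variable {b : BilForm M} (hb : b.IsRegular)

theorem app_act_adjoint (a : (endo M).sec T) {V : C} (g : V ⟶ T) (x y : M.sec V) :
    b.app V (LocHom.app ((b.adjoint hb).app T a) g x) y = b.app V x (LocHom.app a g y) := by
  have h := b.app_adjointHom hb a g (𝟙 V) x y
  rw [M.res_id, M.res_id, Category.id_comp] at h
  exact h

/-- An endomorphism `a` is determined by the forms `b(a(x), y)`. -/
theorem IsRegular.endo_ext (hb : b.IsRegular) {a a' : (endo M).sec T}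
    (h : ∀ {V : C} (g : V ⟶ T) (x y : M.sec V),
      b.app V (LocHom.app a g x) y = b.app V (LocHom.app a' g x) y) :
    a = a' := by
  ext V g x
  refine hb.ext fun W k z => ?_
  rw [LocHom.naturality, LocHom.naturality, h]

theorem isInvolution_adjoint (hs : b.IsSymm) : IsInvolution (b.adjoint hb) where
  map_id T := hb.endo_ext fun g x y => app_act_adjoint hb _ g x y
  map_comp T a a' := hb.endo_ext fun g x y => by
    rw [app_act_adjoint]
    change b.app _ x (LocHom.app a g (LocHom.app a' g y)) =
      b.app _ (LocHom.app ((b.adjoint hb).app T a') g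
        (LocHom.app ((b.adjoint hb).app T a) g x)) y
    rw [app_act_adjoint, app_act_adjoint]
  involutive T a := hb.endo_ext fun g x y => by
    rw [app_act_adjoint, hs, app_act_adjoint, hs]

theorem isOrthogonal_adjoint (hs : b.IsSymm) : IsOrthogonal J (b.adjoint hb) := fun T =>
  ⟨⊤, J.top_mem T, fun V _ _ => ⟨b.toDual.restrict V, fun {W} _ => hb W,
    fun W h x y => by
      change b.app W (M.res (𝟙 W) x) y = b.app W (M.res (𝟙 W) y) x
      rw [M.res_id, M.res_id, hs],
    fun W h a x y => by
      change b.app W (M.res (𝟙 W) (LocHom.app _ (𝟙 W) x)) y =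
        b.app W (M.res (𝟙 W) x) (LocHom.app a (𝟙 W) y)
      rw [M.res_id, M.res_id, app_act_adjoint]⟩⟩

/-- Under `φ_b`, the involution `η_b` is the swap of the two tensor factors. -/
theorem adjoint_phi (hs : b.IsSymm) (t : M.sec T ⊗[𝒪.obj (op T)] M.sec T) :
    (b.adjoint hb).app T (b.phi.app T t) =
      b.phi.app T (TensorProduct.comm (𝒪.obj (op T)) _ _ t) := by
  induction t with
  | zero => simp
  | tmul x y => exact b.adjointHom_rankOne hb hs x y
  | add s t h₁ h₂ => simp only [map_add, h₁, h₂]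

end BilForm

/-! ### Symmetric tensors -/

/-- A submodule containing the diagonal terms `F i i` and the sums `F i j + F j i` of a family
contains the total sum of the family. -/
theorem _root_.Submodule.sum_sum_mem_of_add_mem {R G ι : Type*} [Ring R] [AddCommGroup G]
    [Module R G] (P : Submodule R G) (F : ι → ι → G) (hd : ∀ i, F i i ∈ P)
    (ho : ∀ i j, F i j + F j i ∈ P) (s : Finset ι) : ∑ i ∈ s, ∑ j ∈ s, F i j ∈ P := by
  classical
  induction s using Finset.induction_on with
  | empty => simp
  | insert a s ha ih =>
    have : ∑ i ∈ insert a s, ∑ j ∈ insert a s, F i j =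
        F a a + ∑ i ∈ s, (F a i + F i a) + ∑ i ∈ s, ∑ j ∈ s, F i j := by
      simp only [Finset.sum_insert ha, Finset.sum_add_distrib]
      abel
    rw [this]
    exact P.add_mem (P.add_mem (hd a) (P.sum_mem fun i _ => ho a i)) ih

/-- Over a free module, the tensors fixed by the swap are spanned by the squares `x ⊗ x`. -/
theorem _root_.TensorProduct.mem_span_range_tmul_self {R N ι : Type*} [CommRing R]
    [AddCommGroup N] [Module R N] [Fintype ι] (B : Module.Basis ι R N) {t : N ⊗[R] N}
    (ht : TensorProduct.comm R N N t = t) :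
    t ∈ Submodule.span R (Set.range fun x : N => x ⊗ₜ[R] x) := by
  set P := Submodule.span R (Set.range fun x : N => x ⊗ₜ[R] x)
  have hsq (x : N) : x ⊗ₜ[R] x ∈ P := Submodule.subset_span ⟨x, rfl⟩
  let c := (B.tensorProduct B).repr t
  have hc (i j : ι) : c (i, j) = c (j, i) := by
    have h (z : N ⊗[R] N) : (B.tensorProduct B).repr (TensorProduct.comm R N N z) (i, j) =
        (B.tensorProduct B).repr z (j, i) := by
      induction z with
      | zero => simp
      | tmul x y => simp [mul_comm]
      | add x y hx hy => simp [hx, hy]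
    rw [← h t, ht]
  rw [← (B.tensorProduct B).sum_repr t, Fintype.sum_prod_type]
  refine P.sum_sum_mem_of_add_mem _ (fun i => ?_) (fun i j => ?_) _
  · rw [Module.Basis.tensorProduct_apply]
    exact P.smul_mem _ (hsq _)
  · have h : B i ⊗ₜ[R] B j + B j ⊗ₜ[R] B i =
        (B i + B j) ⊗ₜ[R] (B i + B j) - B i ⊗ₜ[R] B i - B j ⊗ₜ[R] B j := by
      simp only [TensorProduct.add_tmul, TensorProduct.tmul_add]
      abel
    change c (i, j) • _ + c (j, i) • _ ∈ P
    rw [hc j i, ← smul_add, Module.Basis.tensorProduct_apply, Module.Basis.tensorProduct_apply, h]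
    exact P.smul_mem _ (P.sub_mem (P.sub_mem (hsq _) (hsq _)) (hsq _))

namespace BilForm

variable {b : BilForm M} (hb : b.IsRegular) (hs : b.IsSymm)

theorem res_symSquare {V : C} (g : V ⟶ T) (m : M.sec T) :
    (sym (b.adjoint hb)).res g (b.symSquare hb hs m) = b.symSquare hb hs (M.res g m) :=
  Subtype.ext (b.phi.naturality g (m ⊗ₜ m))

theorem symSquare_smul (r : 𝒪.obj (op T)) (m : M.sec T) :
    b.symSquare hb hs (r • m) = (r * r) • b.symSquare hb hs m := by
  apply Subtype.ext
  change b.phi.app T _ = (r * r) • b.phi.app T _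
  rw [TensorProduct.smul_tmul_smul, map_smul]

/-- Polarization of `m ↦ φ_b(m ⊗ m)`: its polar form is `(x, y) ↦ a + η_b(a)`, where
`a = φ_b(x ⊗ y)`. -/
theorem symSquare_add (x y : M.sec T) (s : (sym (b.adjoint hb)).sec T)
    (h : s.1 = b.phi.app T (x ⊗ₜ y) + (b.adjoint hb).app T (b.phi.app T (x ⊗ₜ y))) :
    b.symSquare hb hs (x + y) = b.symSquare hb hs x + b.symSquare hb hs y + s := by
  apply Subtype.ext
  change b.phi.app T _ = b.phi.app T _ + b.phi.app T _ + s.1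
  rw [h, adjoint_phi hb hs, TensorProduct.comm_tmul]
  simp only [TensorProduct.add_tmul, TensorProduct.tmul_add, map_add]
  abel

theorem span_range_symSquare {ι : Type w} [Fintype ι] (B : LocalBasis M T ι) :
    Submodule.span (𝒪.obj (op T)) (Set.range (b.symSquare hb hs (T := T))) = ⊤ := by
  rw [Submodule.eq_top_iff']
  intro s
  obtain ⟨t, ht⟩ := (B.phi_bijective hb).surjective s.1
  have hcomm : TensorProduct.comm (𝒪.obj (op T)) _ _ t = t := by
    apply (B.phi_bijective hb).injective
    rw [← adjoint_phi hb hs, ht]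
    exact s.2
  have hmem := TensorProduct.mem_span_range_tmul_self (B.basis (𝟙 T)) hcomm
  have hmem' := Submodule.mem_map_of_mem (f := b.phi.app T) hmem
  have hsub : (Submodule.span (𝒪.obj (op T)) (Set.range fun m : M.sec T => m ⊗ₜ m)).map
      (b.phi.app T) = (Submodule.span (𝒪.obj (op T))
        (Set.range (b.symSquare hb hs (T := T)))).map
      (LinearMap.eqLocus ((b.adjoint hb).app T) LinearMap.id).subtype := by
    rw [Submodule.map_span, Submodule.map_span, ← Set.range_comp, ← Set.range_comp]
    rfl
  rw [hsub, ht] at hmem'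
  obtain ⟨s', hs', h⟩ := hmem'
  rwa [← Subtype.ext h]

/-- Over an object over which `M` is free, the linear form `f_q` exists: it is induced by any
bilinear form `β`, not necessarily symmetric, with `β(m, m) = q(m)`. -/
theorem exists_linearMap_symSquare {n : ℕ} (B : LocalBasis M T (Fin n)) (q : QuadForm M) :
    ∃ l : (sym (b.adjoint hb)).sec T →ₗ[𝒪.obj (op T)] 𝒪.obj (op T),
      ∀ m, l (b.symSquare hb hs m) = q.app T m := by
  let e := LinearEquiv.ofBijective _ (B.phi_bijective hb)
  refine ⟨TensorProduct.lift ((q.app T).toBilin (B.basis (𝟙 T))) ∘ₗ e.symm.toLinearMap ∘ₗ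
    (LinearMap.eqLocus ((b.adjoint hb).app T) LinearMap.id).subtype, fun m => ?_⟩
  have h : e.symm (b.phi.app T (m ⊗ₜ m)) = m ⊗ₜ m := e.symm_apply_apply _
  change TensorProduct.lift _ (e.symm (b.phi.app T (m ⊗ₜ m))) = _
  rw [h, TensorProduct.lift.tmul, ← LinearMap.BilinMap.toQuadraticMap_apply,
    QuadraticMap.toQuadraticMap_toBilin]

theorem trace_phi_tmul {ι : Type w} [Finite ι] (B : LocalBasis M T ι) (x y : M.sec T) :
    LinearMap.trace (𝒪.obj (op T)) (M.sec T) (LocHom.app (b.phi.app T (x ⊗ₜ y)) (𝟙 T)) =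
      b.app T y x := by
  have := Module.Free.of_basis (B.basis (𝟙 T))
  have := Module.Finite.of_basis (B.basis (𝟙 T))
  change LinearMap.trace _ _ ((b.app T (M.res (𝟙 T) y)).smulRight (M.res (𝟙 T) x)) = _
  rw [LinearMap.trace_smulRight, M.res_id, M.res_id]

/-- The trace condition for quadratic pairs, over an object over which `M` is free, for a linear
form with prescribed values on the squares. -/
theorem apply_eq_trace {ι : Type w} [Finite ι] (B : LocalBasis M T ι) {q : QuadForm M}
    (hq : b = q.polar) (l : (sym (b.adjoint hb)).sec T →ₗ[𝒪.obj (op T)] 𝒪.obj (op T))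
    (hl : ∀ m, l (b.symSquare hb hs m) = q.app T m) (a : (endo M).sec T)
    (s : (sym (b.adjoint hb)).sec T) (h : s.1 = a + (b.adjoint hb).app T a) :
    l s = LinearMap.trace (𝒪.obj (op T)) (M.sec T) (LocHom.app a (𝟙 T)) := by
  -- `ε` is the map `a ↦ a + η_b(a)`; both sides are linear in `a`, so `a = φ_b(x ⊗ y)` suffices.
  let ε : (endo M).sec T →ₗ[𝒪.obj (op T)] (sym (b.adjoint hb)).sec T :=
    LinearMap.codRestrict (LinearMap.eqLocus ((b.adjoint hb).app T) LinearMap.id)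
      (LinearMap.id + (b.adjoint hb).app T) fun a => by
        rw [LinearMap.mem_eqLocus, LinearMap.add_apply, map_add]
        simp only [LinearMap.id_apply]
        rw [(isInvolution_adjoint hb hs).involutive, add_comm]
  obtain rfl : s = ε a := Subtype.ext h
  obtain ⟨t, rfl⟩ := (B.phi_bijective hb).surjective a
  clear h
  induction t using TensorProduct.induction_on with
  | zero =>
    simp only [map_zero]
    exact (map_zero _).symm
  | add t t' h h' =>
    simp only [map_add, h, h']
    exact (map_add _ _ _).symm
  | tmul x y =>
    have hxy := congrArg l (symSquare_add hb hs x y (ε (b.phi.app T (x ⊗ₜ y))) rfl)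
    rw [map_add, map_add, hl, hl, hl] at hxy
    have hqxy : b.app T x y = q.app T (x + y) - q.app T x - q.app T y :=
      congrArg (fun c : BilForm M => c.app T x y) hq
    rw [trace_phi_tmul B, hs, hqxy, hxy]
    ring

end BilForm

/-! ### Quadratic forms and quadratic pairs -/

theorem endo_res_app_id {T V : C} (g : V ⟶ T) (a : (endo M).sec T) :
    LocHom.app ((endo M).res g a) (𝟙 V) = LocHom.app a g :=
  congrArg (LocHom.app a) (Category.id_comp g)

namespace BilForm

variable {b : BilForm M}

/-- Over an object over which `M` is free, a linear form on the symmetric elements is determined by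
its values on the squares. -/
theorem linearMap_ext_symSquare (hb : b.IsRegular) (hs : b.IsSymm) {T : C} {n : ℕ}
    (hT : M.IsFreeOver n T) {l l' : (sym (b.adjoint hb)).sec T →ₗ[𝒪.obj (op T)] 𝒪.obj (op T)}
    (h : ∀ m, l (b.symSquare hb hs m) = l' (b.symSquare hb hs m)) : l = l' := by
  obtain ⟨B⟩ := isFreeOver_iff_exists_localBasis.mp hT
  exact LinearMap.ext_on_range (span_range_symSquare hb hs B) h

/-- The linear form `f_q` attached to a quadratic form `q`, glued from the forms of
`exists_linearMap_symSquare`. -/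
theorem exists_linearForm (h𝒪 : Presieve.IsSheaf J (𝒪 ⋙ forget CommRingCat))
    (hM : M.IsFiniteLocallyFree J) (hb : b.IsRegular) (hs : b.IsSymm) (q : QuadForm M) :
    ∃ f : Mor (sym (b.adjoint hb)) (unit 𝒪),
      ∀ T m, f.app T (b.symSquare hb hs m) = q.app T m := by
  have hloc (T : C) (hT : ∃ n, M.IsFreeOver n T) :
      ∃ l : (sym (b.adjoint hb)).sec T →ₗ[𝒪.obj (op T)] 𝒪.obj (op T),
        ∀ m, l (b.symSquare hb hs m) = q.app T m := by
    obtain ⟨n, hn⟩ := hT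
    obtain ⟨B⟩ := isFreeOver_iff_exists_localBasis.mp hn
    exact exists_linearMap_symSquare hb hs B q
  choose l hl using hloc
  -- The form `β` behind `l` depends on a basis, but `l` is determined by its values on the squares.
  have hres {V W : C} (g : W ⟶ V) (hV : ∃ n, M.IsFreeOver n V) (hW : ∃ n, M.IsFreeOver n W)
      (x : (sym (b.adjoint hb)).sec V) :
      (𝒪.map g.op).hom (l V hV x) = l W hW ((sym (b.adjoint hb)).res g x) := by
    obtain ⟨n, hn⟩ := id hV
    obtain ⟨B⟩ := isFreeOver_iff_exists_localBasis.mp hn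
    have : ((unit 𝒪).res g).comp (l V hV) = (l W hW).comp ((sym (b.adjoint hb)).res g) := by
      refine LinearMap.ext_on_range (span_range_symSquare hb hs B) fun m => ?_
      change (𝒪.map g.op).hom (l V hV _) = l W hW ((sym (b.adjoint hb)).res g _)
      rw [hl, res_symSquare, hl, q.naturality]
    exact LinearMap.congr_fun this x
  obtain ⟨f, hf⟩ := exists_mor_of_locally h𝒪 hM l hres
  refine ⟨f, fun T m => ?_⟩
  obtain ⟨R, hR, h⟩ := hM T
  refine eq_of_locally_eq h𝒪 hR fun V g hg => ?_
  refine (f.naturality g _).trans ?_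
  rw [hf V (h g hg), res_symSquare, hl, q.naturality]

/-- A linear form on the symmetric elements of `η_b` is determined by its values on the squares. -/
theorem linearForm_ext (h𝒪 : Presieve.IsSheaf J (𝒪 ⋙ forget CommRingCat))
    (hM : M.IsFiniteLocallyFree J) (hb : b.IsRegular) (hs : b.IsSymm)
    {f f' : Mor (sym (b.adjoint hb)) (unit 𝒪)}
    (h : ∀ T m, f.app T (b.symSquare hb hs m) = f'.app T (b.symSquare hb hs m)) : f = f' :=
  Mor.ext_of_locally_eq h𝒪 hM fun T ⟨_, hT⟩ => linearMap_ext_symSquare hb hs hT (h T)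

/-- A linear form with values `q(m)` on the squares makes `η_b` a quadratic pair if `b = b_q`. -/
theorem isQuadraticPair_of_eq_polar (hM : M.IsFiniteLocallyFree J) (hb : b.IsRegular)
    (hs : b.IsSymm) {q : QuadForm M} (hq : b = q.polar) (f : Mor (sym (b.adjoint hb)) (unit 𝒪))
    (hf : ∀ T m, f.app T (b.symSquare hb hs m) = q.app T m) :
    IsQuadraticPair J (b.adjoint hb) f where
  azumaya := hM.isAzumayaEnd
  involution := isInvolution_adjoint hb hs
  orthogonal := isOrthogonal_adjoint hb hs
  trace T a s h V g := by
    rintro ⟨n, hV⟩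
    obtain ⟨B⟩ := isFreeOver_iff_exists_localBasis.mp hV
    refine (f.naturality g s).trans ((apply_eq_trace hb hs B hq _ (hf V) ((endo M).res g a) _
      ?_).trans ?_)
    · change (endo M).res g s.1 = _
      rw [h, map_add, (b.adjoint hb).naturality]
    · rw [endo_res_app_id]

/-- If `(η_b, f)` is a quadratic pair, then `m ↦ f(φ_b(m ⊗ m))` has polar form `b`. -/
theorem apply_symSquare_add (h𝒪 : Presieve.IsSheaf J (𝒪 ⋙ forget CommRingCat))
    (hM : M.IsFiniteLocallyFree J) (hb : b.IsRegular) (hs : b.IsSymm)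
    {f : Mor (sym (b.adjoint hb)) (unit 𝒪)} (hf : IsQuadraticPair J (b.adjoint hb) f) {T : C}
    (x y : M.sec T) : f.app T (b.symSquare hb hs (x + y)) =
      f.app T (b.symSquare hb hs x) + f.app T (b.symSquare hb hs y) + b.app T x y := by
  let a := b.phi.app T (x ⊗ₜ y)
  let s : (sym (b.adjoint hb)).sec T := ⟨a + (b.adjoint hb).app T a, by
    rw [LinearMap.mem_eqLocus, map_add, (isInvolution_adjoint hb hs).involutive]
    exact add_comm _ _⟩
  rw [symSquare_add hb hs x y s rfl, map_add, map_add]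
  congr 1
  obtain ⟨R, hR, h⟩ := hM T
  refine eq_of_locally_eq h𝒪 hR fun V g hg => ?_
  obtain ⟨n, hn⟩ := h g hg
  obtain ⟨B⟩ := isFreeOver_iff_exists_localBasis.mp hn
  rw [hf.trace T a s rfl g (h g hg), b.naturality, hs, ← trace_phi_tmul B]
  have h' : b.phi.app V (M.res g x ⊗ₜ M.res g y) = (endo M).res g a :=
    (b.phi.naturality g (x ⊗ₜ y)).symm
  rw [h', endo_res_app_id]

/-- The quadratic form `q_f` attached to a quadratic pair `(η_b, f)`, with its polar form. -/
theorem exists_quadForm (h𝒪 : Presieve.IsSheaf J (𝒪 ⋙ forget CommRingCat))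
    (hM : M.IsFiniteLocallyFree J) (hb : b.IsRegular) (hs : b.IsSymm)
    {f : Mor (sym (b.adjoint hb)) (unit 𝒪)} (hf : IsQuadraticPair J (b.adjoint hb) f) :
    ∃ q : QuadForm M, (∀ T m, q.app T m = f.app T (b.symSquare hb hs m)) ∧ q.polar = b := by
  let q : QuadForm M :=
    { app T :=
        { toFun m := f.app T (b.symSquare hb hs m)
          toFun_smul r m := by rw [symSquare_smul, map_smul]
          exists_companion' := ⟨b.app T, apply_symSquare_add h𝒪 hM hb hs hf⟩ }
      naturality g m := by
        refine (f.naturality g _).trans ?_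
        rw [res_symSquare]
        rfl }
  refine ⟨q, fun _ _ => rfl, ?_⟩
  ext T x y
  change f.app T (b.symSquare hb hs (x + y)) - f.app T (b.symSquare hb hs x) -
    f.app T (b.symSquare hb hs y) = b.app T x y
  rw [apply_symSquare_add h𝒪 hM hb hs hf]
  ring

end BilForm

end

end OMod

/-! ### The structure sheaf of the big fppf site -/

theorem isSheaf_structurePresheaf (S : Scheme.{u}) :
    Presieve.IsSheaf (fppf S) (structurePresheaf S ⋙ forget CommRingCat) :=
  (isSheaf_iff_isSheaf_of_type _ _).mp ((Scheme.fppfTopology.overPullback (Type u) S).obj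
    ⟨Scheme.Γ ⋙ forget CommRingCat, (isSheaf_iff_isSheaf_of_type _ _).mpr
      fun _ R hR => isSheafFor_globalFunctions R hR⟩).property

end QuadPair

open QuadPair.OMod QuadPair.OMod.BilForm in
theorem mainTheorem4 (S : AlgebraicGeometry.Scheme.{u})
    (M : SheafOfModules.{v} (QuadPair.structureSheaf S))
    (hM : (QuadPair.ofSheaf M).IsLocallyFreeOfFinitePositiveRank (QuadPair.fppf S))
    (b : (QuadPair.ofSheaf M).BilForm) (hb : b.IsRegular) (hs : b.IsSymm) :
    -- the setting: `End(M)` is Azumaya, `η_b` is an orthogonal involution, `φ_b` is an isomorphism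
    ((QuadPair.ofSheaf M).IsAzumayaEnd (QuadPair.fppf S) ∧
      QuadPair.OMod.IsInvolution (b.adjoint hb) ∧
      QuadPair.OMod.IsOrthogonal (QuadPair.fppf S) (b.adjoint hb) ∧
      b.phi.IsLocallyBijective (QuadPair.fppf S)) ∧
    -- from a regular quadratic form to a quadratic pair
    (∀ q : (QuadPair.ofSheaf M).QuadForm, q.IsRegular → b = q.polar →
      ∃ f : (QuadPair.OMod.sym (b.adjoint hb)).Mor
          (QuadPair.OMod.unit (QuadPair.structurePresheaf S)),
        (∀ (T : CategoryTheory.Over S) (m : (QuadPair.ofSheaf M).sec T),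
          f.app T (b.symSquare hb hs m) = q.app T m) ∧
        (∀ f' : (QuadPair.OMod.sym (b.adjoint hb)).Mor
            (QuadPair.OMod.unit (QuadPair.structurePresheaf S)),
          (∀ (T : CategoryTheory.Over S) (m : (QuadPair.ofSheaf M).sec T),
            f'.app T (b.symSquare hb hs m) = q.app T m) → f' = f) ∧
        QuadPair.OMod.IsQuadraticPair (QuadPair.fppf S) (b.adjoint hb) f) ∧
    -- from a quadratic pair to a quadratic form
    (∀ f : (QuadPair.OMod.sym (b.adjoint hb)).Mor
        (QuadPair.OMod.unit (QuadPair.structurePresheaf S)),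
      QuadPair.OMod.IsQuadraticPair (QuadPair.fppf S) (b.adjoint hb) f →
      ∃ q : (QuadPair.ofSheaf M).QuadForm,
        (∀ (T : CategoryTheory.Over S) (m : (QuadPair.ofSheaf M).sec T),
          q.app T m = f.app T (b.symSquare hb hs m)) ∧
        (∀ q' : (QuadPair.ofSheaf M).QuadForm,
          (∀ (T : CategoryTheory.Over S) (m : (QuadPair.ofSheaf M).sec T),
            q'.app T m = f.app T (b.symSquare hb hs m)) → q' = q) ∧
        q.polar = b) ∧
    -- the criterion
    ((∃ f : (QuadPair.OMod.sym (b.adjoint hb)).Mor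
        (QuadPair.OMod.unit (QuadPair.structurePresheaf S)),
        QuadPair.OMod.IsQuadraticPair (QuadPair.fppf S) (b.adjoint hb) f) ↔
      ∃ q : (QuadPair.ofSheaf M).QuadForm, q.IsRegular ∧ b = q.polar) := by
  have h𝒪 := QuadPair.isSheaf_structurePresheaf S
  have hM' := hM.isFiniteLocallyFree
  refine ⟨⟨hM'.isAzumayaEnd, isInvolution_adjoint hb hs, isOrthogonal_adjoint hb hs,
    hM'.phi_isLocallyBijective hb⟩, fun q _ hq => ?_, fun f hf => ?_, fun ⟨f, hf⟩ => ?_,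
    fun ⟨q, _, hq⟩ => ?_⟩
  · obtain ⟨f, hf⟩ := exists_linearForm h𝒪 hM' hb hs q
    exact ⟨f, hf, fun f' hf' => linearForm_ext h𝒪 hM' hb hs fun T m => by rw [hf, hf'],
      isQuadraticPair_of_eq_polar hM' hb hs hq f hf⟩
  · obtain ⟨q, hq, hqb⟩ := exists_quadForm h𝒪 hM' hb hs hf
    refine ⟨q, hq, fun q' hq' => ?_, hqb⟩
    ext T m
    rw [hq, hq']
  · obtain ⟨q, -, rfl⟩ := exists_quadForm h𝒪 hM' hb hs hf
    exact ⟨q, hb, rfl⟩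
  · obtain ⟨f, hf⟩ := exists_linearForm h𝒪 hM' hb hs q
    exact ⟨f, isQuadraticPair_of_eq_polar hM' hb hs hq f hf⟩
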